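/- A staged tree $\mathcal S$ is a finite rooted directed tree whose situations (non-leaf vertices) are partitioned into stages $u_1,\dots,u_J$; all situations in the stage $u_j$ have the same number $r_j\ge 1$ of outgoing edges, and these are indexed by $k=1,\dots,r_j$, the $k$-th edges of all situations in $u_j$ being identified with one another. Let $\Lambda(\mathcal S)$ be the set of root-to-leaf paths, and for an edge $e$ let $\Lambda(e)$ be the set of root-to-leaf paths that contain $e$. The tree is square-free if no two situations on the same root-to-leaf path are in the same stage. It represents the set $M(\mathcal S)$ of all distributions $p$ on $\Lambda(\mathcal S)$ of the form $p(\lambda)=\prod_{e\in\lambda}\theta(e)$, where $\theta(e)=\theta_{jk}$ for the $k$-th edge $e$ of a situation in $u_j$, and where every $(\theta_{j1},\dots,\theta_{jr_j})$ is a probability vector with positive entries. Two staged trees $\mathcal S,\mathcal S'$ are statistically equivalent via a bijection $\sigma:\Lambda(\mathcal S)\to\Lambda(\mathcal S')$ if $M(\mathcal S)$ and $M(\mathcal S')$ are the same set when paths are identified by $\sigma$, that is, $M(\mathcal S')=\{p\circ\sigma^{-1}: p\in M(\mathcal S)\}$. For a complete sample in which $n_\lambda\in\mathbb{N}$ (possibly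 $0$) units follow the root-to-leaf path $\lambda$, let $e_{jk}^1,\dots,e_{jk}^{h_j}$ be the $k$-th outgoing edges of the $h_j$ situations in $u_j$, let $n_{jk}=\sum_{m=1}^{h_j}\sum_{\lambda\in\Lambda(e_{jk}^m)}n_\lambda$ and $\overline n_j=\sum_k n_{jk}$. For an imaginary sample size $\alpha>0$ put $$\alpha_{jk}=\frac{\alpha}{|\Lambda(\mathcal S)|}\sum_{m=1}^{h_j}|\Lambda(e_{jk}^m)|,\qquad \overline\alpha_j=\sum_{k=1}^{r_j}\alpha_{jk},$$ $$\mathrm{BDepu}(\mathcal S)=\prod_{j=1}^{J}\left[\frac{\Gamma(\overline\alpha_j)}{\Gamma(\overline\alpha_j+\overline n_j)}\prod_{k=1}^{r_j}\frac{\Gamma(\alpha_{jk}+n_{jk})}{\Gamma(\alpha_{jk})}\right].$$ Theorem 1. Let $\mathcal S$ and $\mathcal S'$ be square-free staged trees, stratified or not, that are statistically equivalent via a bijection $\sigma$ of their root-to-leaf paths. Then $\mathrm{BDepu}(\mathcal S)=\mathrm{BDepu}(\mathcal S')$ for every $\alpha>0$ and every complete sample, where the same sample is used for both trees: if $n_\lambda$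 units follow $\lambda$ in $\mathcal S$, then $n_\lambda$ units follow $\sigma(\lambda)$ in $\mathcal S'$. -/

import Mathlib

noncomputable section

/-- Finite staged tree graphs. Situations are coloured by stages `j : J`; every situation in
stage `j` has `r j` outgoing edges, indexed by `Fin (r j)`, and the index `k` identifies the `k`-th
edges of all the situations of that stage with one another (they carry the same transition
probability). Every finite event tree with a partition of its situations into stages arises in
this way. -/
inductive StagedTree {J : Type*} (r : J → ℕ)
  /-- The tree that consists of a single leaf. -/
  | leaf : StagedTree r
  /-- A root in stage `j` whose `k`-th edge leads to the root of `child k`. -/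
  | node (j : J) (child : Fin (r j) → StagedTree r) : StagedTree r

namespace StagedTree

/-- The root-to-leaf paths `Λ(S)`. -/
def LeafPath {J : Type*} {r : J → ℕ} : StagedTree r → Type
  | leaf => Unit
  | node j child => Σ k : Fin (r j), LeafPath (child k)

/-- The situations of a tree, that is, its vertices that are not leaves: the root (`none`), unless
it is a leaf, and the situations of the subtrees below the root. -/
def Situation {J : Type*} {r : J → ℕ} : StagedTree r → Type
  | leaf => Empty
  | node j child => Option (Σ k : Fin (r j), Situation (child k))

/-- There are finitely many root-to-leaf paths. -/
instance fintypeLeafPath {J : Type*} {r : J → ℕ} : (S : StagedTree r) → Fintype S.LeafPath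
  | leaf => inferInstanceAs (Fintype Unit)
  | node j child =>
      letI := fun k => fintypeLeafPath (child k)
      inferInstanceAs (Fintype (Σ k : Fin (r j), LeafPath (child k)))

/-- There are finitely many situations. -/
instance fintypeSituation {J : Type*} {r : J → ℕ} : (S : StagedTree r) → Fintype S.Situation
  | leaf => inferInstanceAs (Fintype Empty)
  | node j child =>
      letI := fun k => fintypeSituation (child k)
      inferInstanceAs (Fintype (Option (Σ k : Fin (r j), Situation (child k))))

/-- The stage of a situation. -/
def stage {J : Type*} {r : J → ℕ} : (S : StagedTree r) → S.Situation → J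
  | node j _, none => j
  | node _ child, some ⟨k, s⟩ => stage (child k) s

/-- The edges: a situation `s` together with the index of one of its outgoing edges. -/
abbrev Edge {J : Type*} {r : J → ℕ} (S : StagedTree r) : Type :=
  Σ s : S.Situation, Fin (r (S.stage s))

/-- The pair (stage, index) of an edge. Edges with the same label have the same transition
probability. -/
def label {J : Type*} {r : J → ℕ} (S : StagedTree r) (e : S.Edge) : Σ j : J, Fin (r j) :=
  ⟨S.stage e.1, e.2⟩

/-- An edge of the `k`-th subtree below the root, as an edge of the whole tree. -/
def liftEdge {J : Type*} {r : J → ℕ} {j : J} (child : Fin (r j) → StagedTree r) (k : Fin (r j))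
    (e : (child k).Edge) : (node j child).Edge :=
  ⟨some ⟨k, e.1⟩, e.2⟩

open Classical in
/-- The edge set `E(l)` of a root-to-leaf path `l`. -/
def edges {J : Type*} {r : J → ℕ} : (S : StagedTree r) → S.LeafPath → Finset S.Edge
  | leaf, _ => ∅
  | node _ child, ⟨k, l⟩ => insert ⟨none, k⟩ ((edges (child k) l).image (liftEdge child k))

open Classical in
/-- The path set `Λ(e)`: the root-to-leaf paths that contain the edge `e`. -/
def pathSet {J : Type*} {r : J → ℕ} (S : StagedTree r) (e : S.Edge) : Finset S.LeafPath :=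
  Finset.univ.filter fun l => e ∈ S.edges l

open Classical in
/-- The stages that occur in the tree. -/
def stages {J : Type*} {r : J → ℕ} (S : StagedTree r) : Finset J :=
  Finset.univ.image S.stage

open Classical in
/-- The edges with a given label: the `k`-th outgoing edges of the situations in stage `j`. -/
def stageEdges {J : Type*} {r : J → ℕ} (S : StagedTree r) (j : J) (k : Fin (r j)) :
    Finset S.Edge :=
  Finset.univ.filter fun e => S.label e = ⟨j, k⟩

/-- Square-free: no two situations on the same root-to-leaf path are in the same stage. -/
def SquareFree {J : Type*} {r : J → ℕ} (S : StagedTree r) : Prop :=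
  ∀ l : S.LeafPath, ∀ e ∈ S.edges l, ∀ e' ∈ S.edges l, S.stage e.1 = S.stage e'.1 → e.1 = e'.1

/-- The probability of a root-to-leaf path: the product of the transition probabilities along its
edges, where `θ j k` is the transition probability of the `k`-th edge of stage `j`. -/
def pathProb {J : Type*} {r : J → ℕ} (S : StagedTree r) (θ : (j : J) → Fin (r j) → ℝ)
    (l : S.LeafPath) : ℝ :=
  ∏ e ∈ S.edges l, θ (S.stage e.1) e.2

/-- The set of distributions on the root-to-leaf paths that the staged tree represents: one
(strictly positive) vector of transition probabilities is chosen for every stage. -/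
def model {J : Type*} {r : J → ℕ} (S : StagedTree r) : Set (S.LeafPath → ℝ) :=
  {p | ∃ θ : (j : J) → Fin (r j) → ℝ,
    (∀ j k, 0 < θ j k) ∧ (∀ j, ∑ k, θ j k = 1) ∧ p = S.pathProb θ}

/-- Statistical equivalence: when the root-to-leaf paths of the two trees are identified by `σ`,
both trees represent the same set of distributions. -/
def StatEquiv {J J' : Type*} {r : J → ℕ} {r' : J' → ℕ} (S : StagedTree r) (S' : StagedTree r')
    (σ : S.LeafPath ≃ S'.LeafPath) : Prop :=
  (fun p : S.LeafPath → ℝ => p ∘ σ.symm) '' S.model = S'.model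

/-- The number `n_{jk}` of units that arrive at stage `j` and leave it along the `k`-th edge, in
the sample in which `n l` units follow the root-to-leaf path `l`. -/
def count {J : Type*} {r : J → ℕ} (S : StagedTree r) (n : S.LeafPath → ℕ)
    (j : J) (k : Fin (r j)) : ℕ :=
  ∑ e ∈ S.stageEdges j k, ∑ l ∈ S.pathSet e, n l

/-- The BD-metric for hyperparameters `a j k` and the sample with path counts `n`. -/
def BD {J : Type*} {r : J → ℕ} (S : StagedTree r) (n : S.LeafPath → ℕ)
    (a : (j : J) → Fin (r j) → ℝ) : ℝ :=
  ∏ j ∈ S.stages,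
    (Real.Gamma (∑ k, a j k) / Real.Gamma ((∑ k, a j k) + ((∑ k, S.count n j k : ℕ) : ℝ)) *
      ∏ k, Real.Gamma (a j k + (S.count n j k : ℝ)) / Real.Gamma (a j k))

/-- The path-uniform hyperparameters with imaginary sample size `α`. -/
def pathUniform {J : Type*} {r : J → ℕ} (S : StagedTree r) (α : ℝ)
    (j : J) (k : Fin (r j)) : ℝ :=
  α / (Fintype.card S.LeafPath : ℝ) * ∑ e ∈ S.stageEdges j k, ((S.pathSet e).card : ℝ)

/-- The BDepu score. -/
def BDepu {J : Type*} {r : J → ℕ} (S : StagedTree r) (α : ℝ) (n : S.LeafPath → ℕ) : ℝ :=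
  S.BD n (S.pathUniform α)

end StagedTree

end

/-!
The score of a square-free staged tree is determined by its maximal log-likelihood.

For a stage `j` and an index `k` let `A j k` be the set of root-to-leaf paths through an edge with
label `(j, k)`, and let `B j` be the set of paths through stage `j`. In a square-free tree a path
meets every stage at most once, so `B j` is the disjoint union of the `A j k`, and every weight `m`
on the paths has stage counts `m (A j k)` and `m (B j)`, where `m (A) = ∑ l ∈ A, m l`. The tree
therefore enters the score only through the formal combination `∑ j, (∑ k, [A j k] - [B j])` of
path sets, which is encoded by its coefficients `StagedTree.multiplicity`: by
`StagedTree.BDepu_eq_exp`, the logarithm of the score is a sum over path sets `A`, weighted with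
these coefficients, of terms that do not depend on the tree otherwise.

The multiplicities depend on the model alone. By Gibbs' inequality, the maximum over the model of
`∑ l, m l * log (p l)` is the sum of `m (A) * log (m (A))`, weighted with the same coefficients
(`StagedTree.isGreatest_sum_mul_log`). Hence statistically equivalent trees have the same weighted
sum for all positive `m`. Finally, the functions `m ↦ m (A) * log (m (A))`, for nonempty `A`, are
linearly independent (`eq_zero_of_sum_mul_log_eq_zero`): if `B` is a minimal set with a nonzero
coefficient, then its term alone is not differentiable where the mass of `B` tends to zero and the
other masses stay positive. Indicator sums are never proportional without being equal, so no
cancellation can be hidden in multiples of one form. Without square-freeness the counts would weight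
some paths more than once, and would not be indicator sums.
-/

/-! ### Linear independence of `m (A) * log (m (A))` -/

open Filter Topology in
theorem not_differentiableWithinAt_mul_log_zero :
    ¬ DifferentiableWithinAt ℝ (fun x : ℝ => x * Real.log x) (Set.Ioi 0) 0 := by
  intro h
  have h1 := (hasDerivWithinAt_iff_tendsto_slope' (by simp)).1 h.hasDerivWithinAt
  refine not_tendsto_nhds_of_tendsto_atBot Real.tendsto_log_nhdsGT_zero _ (h1.congr' ?_)
  filter_upwards [self_mem_nhdsWithin] with x hx
  have hx' : x ≠ 0 := ne_of_gt hx
  simp only [slope, vsub_eq_sub, smul_eq_mul, Real.log_zero, mul_zero, sub_zero]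
  field_simp

/-- The functions `m ↦ m (A) * log (m (A))` on the positive orthant, where `A` runs over the
nonempty sets, are linearly independent. The coefficient of the empty set is not determined, as its function
vanishes; hence the hypothesis `h0`. -/
theorem eq_zero_of_sum_mul_log_eq_zero {Λ : Type*} [Fintype Λ] [DecidableEq Λ]
    (c : Finset Λ → ℝ) (h0 : c ∅ = 0)
    (h : ∀ m : Λ → ℝ, (∀ l, 0 < m l) →
      ∑ A, c A * ((∑ l ∈ A, m l) * Real.log (∑ l ∈ A, m l)) = 0) :
    c = 0 := by
  funext B
  induction B using Finset.strongInduction with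
  | H B ih =>
  by_contra hB
  simp only [Pi.zero_apply] at hB ih
  have hBne : B.Nonempty := Finset.nonempty_iff_ne_empty.2 (by rintro rfl; exact hB h0)
  have hcard : (0 : ℝ) < B.card := by exact_mod_cast hBne.card_pos
  -- The form of `A` on the ray that gives total mass `ε` to `B` and mass one to the other points.
  let L : Finset Λ → ℝ → ℝ := fun A ε => ((A \ B).card : ℝ) + (A ∩ B).card / B.card * ε
  have hL : ∀ (A : Finset Λ) (ε : ℝ),
      ∑ l ∈ A, (if l ∈ B then ε / (B.card : ℝ) else 1) = L A ε := by
    intro A ε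
    rw [Finset.sum_ite, Finset.filter_mem_eq_inter, Finset.filter_notMem_eq_sdiff]
    simp only [Finset.sum_const, nsmul_eq_mul, L]
    ring
  have hLB : ∀ ε, L B ε = ε := by
    intro ε
    simp only [L, sdiff_self, Finset.bot_eq_empty, Finset.card_empty, Finset.inter_self]
    field_simp
    simp
  -- Along this ray, `-(g ε)` is the term of `B`. All sets in `g` with a nonzero coefficient leave
  -- `B`, by minimality, so their mass stays positive and `g` is differentiable at zero.
  let g : ℝ → ℝ := fun ε => ∑ A ∈ Finset.univ.erase B, c A * (L A ε * Real.log (L A ε))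
  have hg : ∀ ε, 0 < ε → ε * Real.log ε = -(g ε) / c B := by
    intro ε hε
    have := h (fun l => if l ∈ B then ε / (B.card : ℝ) else 1) (by
      intro l; split_ifs <;> positivity)
    simp only [hL] at this
    rw [← Finset.add_sum_erase _ _ (Finset.mem_univ B), hLB] at this
    rw [eq_div_iff hB]
    simp only [g]
    linarith
  have hLd : ∀ A, Differentiable ℝ (L A) := by
    intro A
    simp only [L]
    fun_prop
  have hgd : DifferentiableAt ℝ g 0 := by
    refine DifferentiableAt.fun_sum fun A hA => ?_
    have hAB : A ≠ B := (Finset.mem_erase.1 hA).1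
    by_cases hsub : A ⊆ B
    · simp [ih A (hsub.ssubset_of_ne hAB)]
    · have hpos : L A 0 ≠ 0 := by
        simpa [L] using hsub
      exact (((hLd A) 0).mul (((hLd A) 0).log hpos)).const_mul _
  have hgd' : DifferentiableAt ℝ (fun ε => -(g ε) / c B) 0 := hgd.neg.div_const _
  -- The value at zero agrees by continuity of `x * log x`.
  have hzero : (fun x : ℝ => x * Real.log x) 0 = -(g 0) / c B := by
    refine tendsto_nhds_unique (l := nhdsWithin (0 : ℝ) (Set.Ioi 0))
      (Real.continuous_mul_log.continuousWithinAt) ?_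
    refine (hgd'.continuousAt.continuousWithinAt.tendsto).congr' ?_
    filter_upwards [self_mem_nhdsWithin] with x hx using (hg x hx).symm
  exact not_differentiableWithinAt_mul_log_zero
    (hgd'.differentiableWithinAt.congr (fun x hx => hg x hx) hzero)

/-! ### Maximum likelihood for one stage -/

/-- Gibbs' inequality, for weights `a` that need not sum to one. -/
theorem sum_mul_log_le_sum_mul_log_div_sum {ι : Type*} [Fintype ι] (a t : ι → ℝ)
    (ha : ∀ i, 0 < a i) (ht : ∀ i, 0 < t i) (ht1 : ∑ i, t i = 1) :
    ∑ i, a i * Real.log (t i) ≤ ∑ i, a i * Real.log (a i / ∑ i, a i) := by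
  have hne : (Finset.univ : Finset ι).Nonempty := by
    by_contra hne
    rw [Finset.not_nonempty_iff_eq_empty] at hne
    simp [hne] at ht1
  have hs : 0 < ∑ i, a i := Finset.sum_pos (fun i _ => ha i) hne
  rw [← sub_nonpos, ← Finset.sum_sub_distrib]
  have key : ∀ i, a i * Real.log (t i) - a i * Real.log (a i / ∑ i, a i) ≤
      t i * (∑ i, a i) - a i := by
    intro i
    have hp : 0 < a i / ∑ i, a i := div_pos (ha i) hs
    rw [← mul_sub, ← Real.log_div (ht i).ne' hp.ne']
    have := Real.log_le_sub_one_of_pos (div_pos (ht i) hp)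
    refine (mul_le_mul_of_nonneg_left this (ha i).le).trans_eq ?_
    have := (ha i).ne'
    field_simp
  refine (Finset.sum_le_sum fun i _ => key i).trans_eq ?_
  rw [Finset.sum_sub_distrib, ← Finset.sum_mul, ht1]
  ring

noncomputable section
namespace StagedTree

variable {J : Type*} {r : J → ℕ}

/-! ### Path sets of labels and stages -/

/-- A path leaves a situation along at most one edge. -/
theorem eq_of_mem_edges (S : StagedTree r) (l : S.LeafPath) {e e' : S.Edge}
    (he : e ∈ S.edges l) (he' : e' ∈ S.edges l) (h : e.1 = e'.1) : e = e' := by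
  induction S with
  | leaf => exact e.1.elim
  | node j child ih =>
    obtain ⟨k, l⟩ := l
    simp only [edges, Finset.mem_insert, Finset.mem_image] at he he'
    rcases he with rfl | ⟨f, hf, rfl⟩ <;> rcases he' with rfl | ⟨f', hf', rfl⟩
    · rfl
    · simp [liftEdge] at h
    · simp [liftEdge] at h
    · have h1 : f.1 = f'.1 := eq_of_heq (Sigma.mk.inj (Option.some.inj h)).2
      rw [ih k l hf hf' h1]

theorem nonempty_leafPath (hr : ∀ j, 0 < r j) (S : StagedTree r) : Nonempty S.LeafPath := by
  induction S with
  | leaf => exact ⟨()⟩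
  | node j child ih => exact ⟨⟨⟨0, hr j⟩, (ih _).some⟩⟩

theorem pathSet_nonempty (hr : ∀ j, 0 < r j) (S : StagedTree r) (e : S.Edge) :
    (S.pathSet e).Nonempty := by
  suffices ∃ l, e ∈ S.edges l by
    obtain ⟨l, hl⟩ := this
    exact ⟨l, by simpa [pathSet] using hl⟩
  induction S with
  | leaf => exact e.1.elim
  | node j child ih =>
    obtain ⟨s, i⟩ := e
    rcases s with _ | ⟨k, s⟩
    · refine ⟨⟨i, (nonempty_leafPath hr (child i)).some⟩, ?_⟩
      simp only [edges, Finset.mem_insert]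
      exact Or.inl trivial
    · obtain ⟨l, hl⟩ := ih k ⟨s, i⟩
      refine ⟨⟨k, l⟩, ?_⟩
      simp only [edges, Finset.mem_insert, Finset.mem_image]
      exact Or.inr ⟨_, hl, rfl⟩

open Classical in
/-- The paths through some edge labelled `(j, k)`. -/
def labelPaths (S : StagedTree r) (j : J) (k : Fin (r j)) : Finset S.LeafPath :=
  (S.stageEdges j k).biUnion S.pathSet

open Classical in
/-- The paths that pass through a situation in stage `j`. -/
def stagePaths (S : StagedTree r) (j : J) : Finset S.LeafPath :=
  Finset.univ.biUnion (S.labelPaths j)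

theorem mem_pathSet {S : StagedTree r} {e : S.Edge} {l : S.LeafPath} :
    l ∈ S.pathSet e ↔ e ∈ S.edges l := by simp [pathSet]

theorem mem_stageEdges {S : StagedTree r} {e : S.Edge} {j : J} {k : Fin (r j)} :
    e ∈ S.stageEdges j k ↔ S.label e = ⟨j, k⟩ := by simp [stageEdges]

/-- The path sets of distinct edges with one label are disjoint in a square-free tree. -/
theorem sum_labelPaths {M : Type*} [AddCommMonoid M] {S : StagedTree r} (hS : S.SquareFree)
    (m : S.LeafPath → M) (j : J) (k : Fin (r j)) :
    ∑ l ∈ S.labelPaths j k, m l = ∑ e ∈ S.stageEdges j k, ∑ l ∈ S.pathSet e, m l := by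
  classical
  refine Finset.sum_biUnion fun e he e' he' hne => Finset.disjoint_left.2 fun l hl hl' => hne ?_
  rw [mem_pathSet] at hl hl'
  have h1 : S.stage e.1 = j := congrArg Sigma.fst (mem_stageEdges.1 he)
  have h2 : S.stage e'.1 = j := congrArg Sigma.fst (mem_stageEdges.1 he')
  exact S.eq_of_mem_edges l hl hl' (hS l e hl e' hl' (h1.trans h2.symm))

/-- The path sets of the labels of one stage are disjoint in a square-free tree. -/
theorem sum_stagePaths {M : Type*} [AddCommMonoid M] {S : StagedTree r} (hS : S.SquareFree)
    (m : S.LeafPath → M) (j : J) :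
    ∑ l ∈ S.stagePaths j, m l = ∑ k, ∑ l ∈ S.labelPaths j k, m l := by
  classical
  refine Finset.sum_biUnion fun k _ k' _ hne => Finset.disjoint_left.2 fun l hl hl' => hne ?_
  simp only [labelPaths, Finset.mem_biUnion, mem_pathSet, mem_stageEdges] at hl hl'
  obtain ⟨e, he, hl⟩ := hl
  obtain ⟨e', he', hl'⟩ := hl'
  have h1 : S.stage e.1 = S.stage e'.1 :=
    (congrArg Sigma.fst he).trans (congrArg Sigma.fst he').symm
  obtain rfl := S.eq_of_mem_edges l hl hl' (hS l e hl e' hl' h1)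
  simpa using he.symm.trans he'

theorem labelPaths_nonempty (hr : ∀ j, 0 < r j) {S : StagedTree r} {j : J} (hj : j ∈ S.stages)
    (k : Fin (r j)) : (S.labelPaths j k).Nonempty := by
  simp only [stages, Finset.mem_image, Finset.mem_univ, true_and] at hj
  obtain ⟨s, rfl⟩ := hj
  classical
  exact Finset.Nonempty.biUnion ⟨⟨s, k⟩, mem_stageEdges.2 rfl⟩
    fun e _ => S.pathSet_nonempty hr e

theorem stagePaths_nonempty (hr : ∀ j, 0 < r j) {S : StagedTree r} {j : J} (hj : j ∈ S.stages) :
    (S.stagePaths j).Nonempty := by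
  classical
  exact Finset.Nonempty.biUnion ⟨⟨0, hr j⟩, Finset.mem_univ _⟩
    fun k _ => labelPaths_nonempty hr hj k

/-! ### Multiplicities of path sets -/

/-- The multiplicity of the path set `A`: the number of labels `(j, k)` whose path set is `A`
minus the number of stages whose path set is `A`. Only stages that occur in the tree count. It is
real-valued, to serve as a coefficient. -/
def multiplicity (S : StagedTree r) : Finset S.LeafPath → ℝ := by
  classical exact fun A =>
    ∑ j ∈ S.stages, ((∑ k, if S.labelPaths j k = A then 1 else 0) -
      if S.stagePaths j = A then 1 else 0)

theorem sum_multiplicity_mul (S : StagedTree r) (f : Finset S.LeafPath → ℝ) :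
    ∑ A, S.multiplicity A * f A =
      ∑ j ∈ S.stages, ((∑ k, f (S.labelPaths j k)) - f (S.stagePaths j)) := by
  classical
  simp only [multiplicity, Finset.sum_mul, sub_mul]
  rw [Finset.sum_comm]
  refine Finset.sum_congr rfl fun j _ => ?_
  rw [Finset.sum_sub_distrib, Finset.sum_comm]
  simp

theorem multiplicity_empty (hr : ∀ j, 0 < r j) (S : StagedTree r) : S.multiplicity ∅ = 0 := by
  refine Finset.sum_eq_zero fun j hj => ?_
  simp [(stagePaths_nonempty hr hj).ne_empty, (labelPaths_nonempty hr hj _).ne_empty]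

/-! ### The maximal log-likelihood determines the multiplicities -/

theorem sum_mul_log_pathProb (S : StagedTree r) (θ : (j : J) → Fin (r j) → ℝ)
    (hθ : ∀ j k, 0 < θ j k) (m : S.LeafPath → ℝ) :
    ∑ l, m l * Real.log (S.pathProb θ l) =
      ∑ j ∈ S.stages, ∑ k, (∑ e ∈ S.stageEdges j k, ∑ l ∈ S.pathSet e, m l) *
        Real.log (θ j k) := by
  classical
  have h1 : ∀ l, m l * Real.log (S.pathProb θ l) =
      ∑ e, if e ∈ S.edges l then m l * Real.log (θ (S.stage e.1) e.2) else 0 := by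
    intro l
    rw [pathProb, Real.log_prod fun e _ => (hθ _ _).ne', Finset.mul_sum, Finset.sum_ite_mem,
      Finset.univ_inter]
  simp only [h1]
  rw [Finset.sum_comm]
  have h2 : ∀ e : S.Edge, (∑ l, if e ∈ S.edges l then m l * Real.log (θ (S.stage e.1) e.2) else 0)
      = (∑ l ∈ S.pathSet e, m l) * Real.log (θ (S.stage e.1) e.2) := by
    intro e
    rw [pathSet, Finset.sum_filter, Finset.sum_mul]
    simp only [ite_mul, zero_mul]
  simp only [h2]
  -- Group the edges by their labels.
  rw [Finset.sum_sigma' S.stages (fun _ => Finset.univ) (f := fun j k =>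
    (∑ e ∈ S.stageEdges j k, ∑ l ∈ S.pathSet e, m l) * Real.log (θ j k)),
    ← Finset.sum_fiberwise_of_maps_to (g := S.label)
      (t := S.stages.sigma fun _ => Finset.univ) (by
        intro e _
        simp [label, stages])]
  refine Finset.sum_congr rfl fun x _ => ?_
  rw [Finset.sum_mul]
  refine Finset.sum_congr (by ext; simp [stageEdges]) fun e he => ?_
  obtain rfl : S.label e = x := mem_stageEdges.1 he
  rfl

/-- The maximal log-likelihood for positive path weights `m`; it is attained at the relative
frequencies `m (A j k) / m (B j)`. -/
theorem isGreatest_sum_mul_log (hr : ∀ j, 0 < r j) {S : StagedTree r} (hS : S.SquareFree)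
    (m : S.LeafPath → ℝ) (hm : ∀ l, 0 < m l) :
    IsGreatest ((fun p : S.LeafPath → ℝ => ∑ l, m l * Real.log (p l)) '' S.model)
      (∑ A, S.multiplicity A * ((∑ l ∈ A, m l) * Real.log (∑ l ∈ A, m l))) := by
  classical
  let a : (j : J) → Fin (r j) → ℝ := fun j k => ∑ l ∈ S.labelPaths j k, m l
  have ha : ∀ j ∈ S.stages, ∀ k, 0 < a j k := fun j hj k =>
    Finset.sum_pos (fun l _ => hm l) (labelPaths_nonempty hr hj k)
  have hsum : ∀ j ∈ S.stages, 0 < ∑ k, a j k := fun j hj =>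
    Finset.sum_pos (fun k _ => ha j hj k) ⟨⟨0, hr j⟩, Finset.mem_univ _⟩
  have hval : ∑ A, S.multiplicity A * ((∑ l ∈ A, m l) * Real.log (∑ l ∈ A, m l)) =
      ∑ j ∈ S.stages, ∑ k, a j k * Real.log (a j k / ∑ k, a j k) := by
    rw [sum_multiplicity_mul S fun A => (∑ l ∈ A, m l) * Real.log (∑ l ∈ A, m l)]
    refine Finset.sum_congr rfl fun j hj => ?_
    rw [sum_stagePaths hS, Finset.sum_mul, ← Finset.sum_sub_distrib]
    refine Finset.sum_congr rfl fun k _ => ?_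
    rw [Real.log_div (ha j hj k).ne' (hsum j hj).ne', mul_sub]
  rw [hval]
  constructor
  · -- Stages that do not occur have no data; any positive distribution will do there.
    let θ : (j : J) → Fin (r j) → ℝ := fun j k =>
      if j ∈ S.stages then a j k / ∑ k, a j k else 1 / r j
    have hθ : ∀ j k, 0 < θ j k := by
      intro j k
      have : (0 : ℝ) < r j := by exact_mod_cast hr j
      simp only [θ]
      split_ifs with hj
      · exact div_pos (ha j hj k) (hsum j hj)
      · positivity
    refine ⟨S.pathProb θ, ⟨θ, hθ, fun j => ?_, rfl⟩, ?_⟩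
    · have : (r j : ℝ) ≠ 0 := by exact_mod_cast (hr j).ne'
      by_cases hj : j ∈ S.stages
      · simp only [θ, hj, if_true]
        rw [← Finset.sum_div, div_self (hsum j hj).ne']
      · simp [θ, hj, this]
    · dsimp only
      rw [sum_mul_log_pathProb S θ hθ]
      refine Finset.sum_congr rfl fun j hj => Finset.sum_congr rfl fun k _ => ?_
      rw [← sum_labelPaths hS]
      simp only [θ, hj, if_true, a]
  · rintro _ ⟨_, ⟨θ, hθ, hθ1, rfl⟩, rfl⟩
    dsimp only
    rw [sum_mul_log_pathProb S θ hθ]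
    refine Finset.sum_le_sum fun j hj => ?_
    simp only [← sum_labelPaths hS]
    exact sum_mul_log_le_sum_mul_log_div_sum (a j) (θ j) (ha j hj) (hθ j) (hθ1 j)

/-- Statistically equivalent square-free trees have the same multiplicities. -/
theorem multiplicity_map {J' : Type*} {r' : J' → ℕ}
    (hr : ∀ j, 0 < r j) (hr' : ∀ j, 0 < r' j) {S : StagedTree r} {S' : StagedTree r'}
    (hS : S.SquareFree) (hS' : S'.SquareFree)
    (σ : S.LeafPath ≃ S'.LeafPath) (hσ : StatEquiv S S' σ) (A : Finset S.LeafPath) :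
    S'.multiplicity (A.map σ.toEmbedding) = S.multiplicity A := by
  classical
  have key : (fun A => S'.multiplicity (A.map σ.toEmbedding) - S.multiplicity A) = 0 := by
    refine eq_zero_of_sum_mul_log_eq_zero _ (by simp [multiplicity_empty hr,
      multiplicity_empty hr']) fun m hm => ?_
    have h1 := isGreatest_sum_mul_log hr hS m hm
    have h2 := isGreatest_sum_mul_log hr' hS' (m ∘ σ.symm) fun l => hm _
    rw [← hσ, Set.image_image] at h2
    have h3 : ∀ p : S.LeafPath → ℝ,
        ∑ l, (m ∘ σ.symm) l * Real.log ((p ∘ σ.symm) l) = ∑ l, m l * Real.log (p l) := fun p =>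
      Equiv.sum_comp σ.symm fun l => m l * Real.log (p l)
    simp only [h3] at h2
    rw [← (Equiv.finsetCongr σ).sum_comp] at h2
    simp only [Equiv.finsetCongr_apply, Finset.sum_map, Equiv.coe_toEmbedding,
      Function.comp_apply, Equiv.symm_apply_apply] at h2
    simp only [sub_mul, Finset.sum_sub_distrib]
    rw [h2.unique h1, sub_self]
  exact sub_eq_zero.1 (congrFun key A)

/-! ### The score in terms of multiplicities -/

theorem pathUniform_eq {S : StagedTree r} (hS : S.SquareFree) (α : ℝ) (j : J) (k : Fin (r j)) :
    S.pathUniform α j k = ∑ _l ∈ S.labelPaths j k, α / (Fintype.card S.LeafPath : ℝ) := by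
  rw [sum_labelPaths hS, pathUniform, Finset.mul_sum]
  refine Finset.sum_congr rfl fun e _ => ?_
  rw [Finset.sum_const, nsmul_eq_mul, mul_comm]

/-- The score depends on the tree only through the number of paths and the multiplicities. -/
theorem BDepu_eq_exp (hr : ∀ j, 0 < r j) {S : StagedTree r} (hS : S.SquareFree)
    {α : ℝ} (hα : 0 < α) (n : S.LeafPath → ℕ) :
    S.BDepu α n = Real.exp (∑ A, S.multiplicity A *
      (Real.log (Real.Gamma (∑ l ∈ A, (α / (Fintype.card S.LeafPath : ℝ) + n l))) -
        Real.log (Real.Gamma (∑ _l ∈ A, α / (Fintype.card S.LeafPath : ℝ))))) := by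
  have := nonempty_leafPath hr S
  have hc : 0 < α / (Fintype.card S.LeafPath : ℝ) := by
    have := Fintype.card_pos (α := S.LeafPath)
    positivity
  have hU := pathUniform_eq hS α
  rw [BDepu, BD]
  generalize α / (Fintype.card S.LeafPath : ℝ) = c at hc hU ⊢
  have hG : ∀ A : Finset S.LeafPath, A.Nonempty →
      0 < Real.Gamma (∑ l ∈ A, (c + n l)) ∧ 0 < Real.Gamma (∑ _l ∈ A, c) := fun A hA =>
    ⟨Real.Gamma_pos_of_pos (Finset.sum_pos (fun l _ => by positivity) hA),
      Real.Gamma_pos_of_pos (Finset.sum_pos (fun l _ => hc) hA)⟩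
  rw [sum_multiplicity_mul S fun A => Real.log (Real.Gamma (∑ l ∈ A, (c + n l))) -
        Real.log (Real.Gamma (∑ _l ∈ A, c)), Real.exp_sum]
  refine Finset.prod_congr rfl fun j hj => ?_
  obtain ⟨h1, h2⟩ := hG _ (stagePaths_nonempty hr hj)
  have e1 : ∀ k, S.pathUniform α j k = ∑ _l ∈ S.labelPaths j k, c := hU j
  have e2 : ∀ k, S.count n j k = ∑ l ∈ S.labelPaths j k, n l := fun k =>
    (sum_labelPaths hS n j k).symm
  simp only [e1, e2, ← sum_stagePaths hS]
  push_cast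
  simp only [← Finset.sum_add_distrib]
  rw [Real.exp_sub, Real.exp_sum, Real.exp_sub, Real.exp_log h1, Real.exp_log h2]
  have e3 : ∀ k, Real.exp (Real.log (Real.Gamma (∑ l ∈ S.labelPaths j k, (c + n l))) -
        Real.log (Real.Gamma (∑ _l ∈ S.labelPaths j k, c))) =
      Real.Gamma (∑ l ∈ S.labelPaths j k, (c + n l)) /
        Real.Gamma (∑ _l ∈ S.labelPaths j k, c) := by
    intro k
    obtain ⟨h3, h4⟩ := hG _ (labelPaths_nonempty hr hj k)
    rw [Real.exp_sub, Real.exp_log h3, Real.exp_log h4]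
  simp only [e3]
  rw [div_div_eq_mul_div, mul_div_assoc, mul_comm]

end StagedTree
end

theorem theorem1 {J J' : Type*} {r : J → ℕ} {r' : J' → ℕ}
    (hr : ∀ j, 0 < r j) (hr' : ∀ j, 0 < r' j)
    (S : StagedTree r) (S' : StagedTree r')
    (hS : S.SquareFree) (hS' : S'.SquareFree)
    (σ : S.LeafPath ≃ S'.LeafPath) (hσ : StagedTree.StatEquiv S S' σ)
    (α : ℝ) (hα : 0 < α) (n : S.LeafPath → ℕ) :
    S.BDepu α n = S'.BDepu α (n ∘ σ.symm) := by
  rw [StagedTree.BDepu_eq_exp hr hS hα, StagedTree.BDepu_eq_exp hr' hS' hα,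
    ← (Equiv.finsetCongr σ).sum_comp]
  simp only [Equiv.finsetCongr_apply, StagedTree.multiplicity_map hr hr' hS hS' σ hσ,
    Finset.sum_map, Equiv.coe_toEmbedding, Function.comp_apply, Equiv.symm_apply_apply,
    Fintype.card_congr σ]
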